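/- **Definitions.** For a group $G$ write $y^x=xyx^{-1}$, $[x,y]=xyx^{-1}y^{-1}$, $\{x,y\}=xyx^{-1}y$, and let $S(G)$ be the subgroup generated by the squares $x^2$, $x\in G$. Let $(G,G)$ be the free group on the symbols $\langle x,y\rangle$, $(x,y)$ and $(z)$ with $x,y,z\in G$, and let $(G,G)\to S(G)$ be the homomorphism with $\langle x,y\rangle\mapsto[x,y]$, $(x,y)\mapsto\{x,y\}$, $(z)\mapsto z^2$. Let $K'$ be its kernel. Put $\langle y,z\rangle^x=\langle y^x,z^x\rangle$ and $(y,z)^x=(y^x,z^x)$. The *unoriented Schur multiplier* is $\mathcal M(G;\mathbb Z_2)=K'/N$, where $N$ is the normal subgroup of $(G,G)$ generated by the relations, for $x,y,z\in G$ and $i,j\in\mathbb Z$, $$(x^i)(x^j)\sim(x^{i+j}),\qquad (x,xy)\sim(x)(y),\qquad \langle x,y\rangle\sim(x)(x^{-1}y)(y^{-1}),$$ $$\langle xy,z\rangle\sim(y,z)^x(x,z^{-1}),\qquad \langle y,z\rangle^x\sim\langle x,[y,z]\rangle\langle y,z\rangle,$$ $$(y,z)^x\sim\langle x,\{y,z\}\rangle(y,z),\qquad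 (y^x,z^x)^{-1}\sim(x,\{y,z\}^{-1})(y,z).$$ It is an abelian group. The *unoriented Bogomolov multiplier* $B_0(G;\mathbb Z_2)$ is the quotient of $\mathcal M(G;\mathbb Z_2)$ by the subgroup generated by the classes of $\langle x,y\rangle$ with $[x,y]=1$ (classes over the torus), of $(x,y)$ with $\{x,y\}=1$ (classes over the Klein bottle), and of $(z)$ with $z^2=1$ (classes over the projective plane $\mathbb{R}P^2$). **Theorem.** Let $G$ be a finite abelian group, a dihedral group $D_{2n}=\langle a,b : a^2=b^2=(ab)^n=1\rangle$ of order $2n$ with $n\ge 1$, or a symmetric group $S_n$ with $n\ge 0$. Then $\mathcal M(G;\mathbb Z_2)$ is generated by the classes over the torus, the Klein bottle and the projective plane; that is, the unoriented Bogomolov multiplier $B_0(G;\mathbb Z_2)$ is trivial. -/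

import Mathlib

universe u

namespace Unoriented

/-- The letters of the free group `(G, G)`: the oriented pairs `⟨x, y⟩`, the unoriented pairs
`(x, y)` and the square elements `(z)`. -/
inductive Letter (G : Type u) : Type u
  | oriented (x y : G) : Letter G
  | unoriented (x y : G) : Letter G
  | square (z : G) : Letter G

/-- The free group `(G, G)` on the symbols `⟨x, y⟩`, `(x, y)` and `(z)`. -/
abbrev PairGroup (G : Type u) : Type u := FreeGroup (Letter G)

section

variable {G : Type u}

/-- The generator `⟨x, y⟩`. -/
abbrev ori (x y : G) : PairGroup G := FreeGroup.of (Letter.oriented x y)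

/-- The generator `(x, y)`. -/
abbrev uno (x y : G) : PairGroup G := FreeGroup.of (Letter.unoriented x y)

/-- The generator `(z)`. -/
abbrev sqr (z : G) : PairGroup G := FreeGroup.of (Letter.square z)

end

section

variable {G : Type u} [Group G]

/-- The conjugate `y ^ x = x y x⁻¹`. -/
def cj (x y : G) : G := x * y * x⁻¹

/-- The commutator `[x, y] = x y x⁻¹ y⁻¹`. -/
def comm (x y : G) : G := x * y * x⁻¹ * y⁻¹

/-- The unoriented commutator `{x, y} = x y x⁻¹ y`. -/
def ucomm (x y : G) : G := x * y * x⁻¹ * y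

variable (G) in
/-- The subgroup `S(G)` generated by the squares of `G`. -/
def squareSubgroup : Subgroup G := Subgroup.closure {g : G | ∃ x : G, g = x ^ 2}

theorem sq_mem (x : G) : x ^ 2 ∈ squareSubgroup G := Subgroup.subset_closure ⟨x, rfl⟩

theorem ucomm_mem (x y : G) : ucomm x y ∈ squareSubgroup G := by
  have h : ucomm x y = x ^ 2 * (x⁻¹ * y) ^ 2 := by simp only [ucomm, pow_two]; group
  rw [h]; exact mul_mem (sq_mem _) (sq_mem _)

theorem comm_mem (x y : G) : comm x y ∈ squareSubgroup G := by
  have h : comm x y = x ^ 2 * (x⁻¹ * y) ^ 2 * (y⁻¹) ^ 2 := by simp only [comm, pow_two]; group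
  rw [h]; exact mul_mem (mul_mem (sq_mem _) (sq_mem _)) (sq_mem _)

/-- The value of a letter in `S(G)`: `⟨x, y⟩ ↦ [x, y]`, `(x, y) ↦ {x, y}`, `(z) ↦ z ^ 2`. -/
def letterValue : Letter G → squareSubgroup G
  | .oriented x y => ⟨comm x y, comm_mem x y⟩
  | .unoriented x y => ⟨ucomm x y, ucomm_mem x y⟩
  | .square z => ⟨z ^ 2, sq_mem z⟩

variable (G) in
/-- The canonical homomorphism `(G, G) → S(G)`. -/
def canonicalMap : PairGroup G →* squareSubgroup G := FreeGroup.lift letterValue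

/-- The seven families of relations `u ∼ v` that define the unoriented Schur multiplier.
The conjugate of a pair is the pair of conjugates. -/
inductive Relation : PairGroup G → PairGroup G → Prop
  | r1 (x : G) (i j : ℤ) : Relation (sqr (x ^ i) * sqr (x ^ j)) (sqr (x ^ (i + j)))
  | r2 (x y : G) : Relation (uno x (x * y)) (sqr x * sqr y)
  | r3 (x y : G) : Relation (ori x y) (sqr x * sqr (x⁻¹ * y) * sqr y⁻¹)
  | r4 (x y z : G) : Relation (ori (x * y) z) (uno (cj x y) (cj x z) * uno x z⁻¹)
  | r5 (x y z : G) : Relation (ori (cj x y) (cj x z)) (ori x (comm y z) * ori y z)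
  | r6 (x y z : G) : Relation (uno (cj x y) (cj x z)) (ori x (ucomm y z) * uno y z)
  | r7 (x y z : G) : Relation (uno (cj x y) (cj x z))⁻¹ (uno x (ucomm y z)⁻¹ * uno y z)

variable (G) in
/-- The normal subgroup of `(G, G)` generated by the seven families of relations. -/
def relationSubgroup : Subgroup (PairGroup G) :=
  Subgroup.normalClosure {w | ∃ u v : PairGroup G, Relation u v ∧ w = u * v⁻¹}

instance : (relationSubgroup G).Normal := Subgroup.normalClosure_normal

variable (G) in
/-- The kernel `K'` of the canonical map `(G, G) → S(G)`. -/
def pairKernel : Subgroup (PairGroup G) := (canonicalMap G).ker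

/-- The relations hold in `S(G)`, so that they generate a subgroup of the kernel. -/
theorem relationSubgroup_le : relationSubgroup G ≤ pairKernel G := by
  have : (pairKernel G).Normal := by unfold pairKernel; infer_instance
  refine Subgroup.normalClosure_le_normal ?_
  rintro _ ⟨u, v, h, rfl⟩
  simp only [SetLike.mem_coe, pairKernel, MonoidHom.mem_ker, map_mul, map_inv, mul_inv_eq_one]
  cases h <;> apply Subtype.ext <;>
    simp [canonicalMap, letterValue, comm, ucomm, cj, pow_two] <;> group

variable (G) in
/-- The unoriented Schur multiplier `M(G; ℤ₂) = K' / N`. -/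
abbrev SchurMultiplier : Type u := pairKernel G ⧸ (relationSubgroup G).subgroupOf (pairKernel G)

/-! ### The unoriented Schur multiplier is abelian -/

/-- The class of a word in `(G, G) / N`. -/
abbrev cls (w : PairGroup G) : PairGroup G ⧸ relationSubgroup G := QuotientGroup.mk w

theorem cls_mul (v w : PairGroup G) : cls (v * w) = cls v * cls w := rfl

theorem cls_rel {u v : PairGroup G} (h : Relation u v) : cls u = cls v := by
  rw [cls, cls, ← mul_inv_eq_one, ← QuotientGroup.mk_inv, ← QuotientGroup.mk_mul,
    QuotientGroup.eq_one_iff]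
  exact Subgroup.subset_normalClosure ⟨u, v, h, rfl⟩

theorem cls_sqr_one : cls (sqr (1 : G)) = 1 := by
  have := cls_rel (Relation.r1 (1 : G) 0 0)
  simpa using this

theorem cls_sqr_inv (x : G) : cls (sqr x⁻¹) = (cls (sqr x))⁻¹ := by
  have := cls_rel (Relation.r1 x (-1) 1)
  simp only [zpow_neg, zpow_one, neg_add_cancel, zpow_zero, cls_sqr_one,
    QuotientGroup.mk_mul] at this
  exact eq_inv_of_mul_eq_one_left this

theorem cls_uno (x y : G) : cls (uno x y) = cls (sqr x) * cls (sqr (x⁻¹ * y)) := by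
  have := cls_rel (Relation.r2 x (x⁻¹ * y))
  simpa using this

theorem cls_ori (x y : G) :
    cls (ori x y) = cls (sqr x) * cls (sqr (x⁻¹ * y)) * (cls (sqr y))⁻¹ := by
  rw [← cls_sqr_inv]
  simpa using cls_rel (Relation.r3 x y)

theorem cls_sqr_mul (x y : G) : cls (sqr x) * cls (sqr y) = cls (ori x (x * y)) * cls (sqr (x * y)) := by
  rw [cls_ori]; simp

theorem cls_ori_inv (x y : G) : cls (ori x y) * cls (ori y x) = 1 := by
  have : x⁻¹ * y = (y⁻¹ * x)⁻¹ := by group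
  rw [cls_ori, cls_ori, this, cls_sqr_inv]; group

theorem cls_conj_sqr (x z : G) : cls (sqr (cj x z)) =
    cls (sqr x) * cls (sqr (x⁻¹ * z)) * (cls (sqr z))⁻¹ * cls (sqr (z * x)) * (cls (sqr x))⁻¹ := by
  have h := cls_rel (Relation.r4 x 1 z)
  have e1 : cj x (1 : G) = 1 := by simp [cj]
  have e2 : x⁻¹ * z⁻¹ = (z * x)⁻¹ := by group
  rw [cls_mul, mul_one] at h
  rw [cls_ori, cls_uno, cls_uno, e1, e2, cls_sqr_inv, cls_sqr_one, inv_one, one_mul, one_mul] at h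
  rw [← mul_inv_eq_iff_eq_mul] at h
  rw [← h]; group

/-- The map on `(G, G)` induced by conjugation by `x`. -/
def letterConj (x : G) : Letter G → Letter G
  | .oriented y z => .oriented (cj x y) (cj x z)
  | .unoriented y z => .unoriented (cj x y) (cj x z)
  | .square z => .square (cj x z)

theorem cj_cj (x y z : G) : cj x (cj y z) = cj (x * y) z := by simp only [cj]; group

theorem cj_one (z : G) : cj 1 z = z := by simp [cj]

theorem cj_mul (x y z : G) : cj x (y * z) = cj x y * cj x z := by simp only [cj]; group

theorem cj_inv (x y : G) : cj x y⁻¹ = (cj x y)⁻¹ := by simp only [cj]; group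

theorem letterConj_mul (x y : G) (t : PairGroup G) :
    FreeGroup.map (letterConj x) (FreeGroup.map (letterConj y) t) =
      FreeGroup.map (letterConj (x * y)) t := by
  rw [FreeGroup.map.comp]
  congr 2
  funext l; cases l <;> simp [letterConj, cj_cj]

theorem letterConj_one (t : PairGroup G) : FreeGroup.map (letterConj (1 : G)) t = t := by
  have : letterConj (1 : G) = id := by funext l; cases l <;> simp [letterConj, cj_one]
  rw [this, FreeGroup.map.id]

theorem cls_ori_mul (x y z : G) :
    cls (ori (x * y) z) = cls (ori (cj x y) (cj x z)) * cls (ori x z) := by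
  have h := cls_rel (Relation.r4 x y z)
  rw [cls_mul] at h
  have h1 := cls_rel (Relation.r4 x 1 z)
  rw [cls_mul, mul_one] at h1
  have e1 : cj x (1 : G) = 1 := by simp [cj]
  rw [cls_uno (cj x 1), e1, cls_sqr_one, inv_one, one_mul, one_mul] at h1
  rw [h, h1, cls_uno (cj x y), cls_ori (cj x y)]; group

theorem cls_sqr_conj_sqr (a b : G) :
    cls (sqr a) * cls (sqr b) * (cls (sqr a))⁻¹ = cls (sqr (cj (a ^ 2) b)) := by
  obtain ⟨u, rfl⟩ : ∃ u, b = u * a := ⟨b * a⁻¹, by group⟩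
  have hx : cj (a ^ 2) (u * a) = cj a (a * u) := by simp only [cj, pow_two]; group
  have e1 : a⁻¹ * (a * u) = u := by group
  have e2 := cls_sqr_mul u (u⁻¹ * a⁻¹)
  have e3 := cls_sqr_mul a⁻¹ (a * u * a)
  have e4 := cls_ori_mul u a a⁻¹
  have e5 : cls (ori (cj u a) (cj u a⁻¹)) = 1 := by
    rw [cj_inv, cls_ori]
    have h := cls_rel (Relation.r1 (cj u a) (-1) (-1))
    have f : cj u a ^ (-1 + -1 : ℤ) = (cj u a)⁻¹ * (cj u a)⁻¹ := by group
    rw [cls_mul, f, zpow_neg_one, cls_sqr_inv] at h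
    rw [← h, cls_sqr_inv]; group
  rw [e5, one_mul] at e4
  have e6 := cls_ori_inv (u * a) a⁻¹
  have f1 : u * (u⁻¹ * a⁻¹) = a⁻¹ := by group
  have f2 : a⁻¹ * (a * u * a) = u * a := by group
  have f3 : u⁻¹ * a⁻¹ = (a * u)⁻¹ := by group
  rw [f1, f3, cls_sqr_inv] at e2
  rw [f2] at e3
  rw [e4] at e6
  have key : cls (sqr u) * (cls (sqr (a * u)))⁻¹ * cls (sqr (a * u * a)) = cls (sqr (u * a)) := by
    rw [e2, mul_assoc, e3, ← mul_assoc, e6, one_mul]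
  rw [hx, cls_conj_sqr, e1, ← key]; group

theorem conj_cls_sqr (a : G) (t : PairGroup G) :
    cls (sqr a) * cls t * (cls (sqr a))⁻¹ = cls (FreeGroup.map (letterConj (a ^ 2)) t) := by
  have ind : ∀ l, cls (sqr a) * cls (FreeGroup.of l) * (cls (sqr a))⁻¹ =
      cls (FreeGroup.map (letterConj (a ^ 2)) (FreeGroup.of l)) := by
    intro l
    rw [FreeGroup.map.of]
    cases l with
    | square z => exact cls_sqr_conj_sqr a z
    | unoriented x y =>
      change _ * cls (uno x y) * _ = cls (uno _ _)
      rw [cls_uno, cls_uno, ← cj_inv, ← cj_mul, ← cls_sqr_conj_sqr, ← cls_sqr_conj_sqr]; group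
    | oriented x y =>
      change _ * cls (ori x y) * _ = cls (ori _ _)
      rw [cls_ori, cls_ori, ← cj_inv, ← cj_mul, ← cls_sqr_conj_sqr, ← cls_sqr_conj_sqr,
        ← cls_sqr_conj_sqr]; group
  have : ((MulAut.conj (cls (sqr a))).toMonoidHom.comp (QuotientGroup.mk' (relationSubgroup G))) =
      (QuotientGroup.mk' (relationSubgroup G)).comp (FreeGroup.map (letterConj (a ^ 2))) := by
    ext l
    exact ind l
  exact DFunLike.congr_fun this t

/-- Conjugation by a word acts on classes through the value of the word. -/
theorem conj_cls (p : PairGroup G) : ∀ t : PairGroup G, cls p * cls t * (cls p)⁻¹ =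
    cls (FreeGroup.map (letterConj (canonicalMap G p : G)) t) := by
  have hsq : ∀ a : G, (canonicalMap G (sqr a) : G) = a ^ 2 := by
    intro a; simp [canonicalMap, letterValue]
  have hmul : ∀ p q : PairGroup G,
      (∀ t, cls p * cls t * (cls p)⁻¹ =
        cls (FreeGroup.map (letterConj (canonicalMap G p : G)) t)) →
      (∀ t, cls q * cls t * (cls q)⁻¹ =
        cls (FreeGroup.map (letterConj (canonicalMap G q : G)) t)) →
      ∀ t, cls (p * q) * cls t * (cls (p * q))⁻¹ =
        cls (FreeGroup.map (letterConj (canonicalMap G (p * q) : G)) t) := by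
    intro p q hp hq t
    rw [map_mul, Subgroup.coe_mul, ← letterConj_mul, ← hp, ← hq, cls, cls, QuotientGroup.mk_mul]
    group
  have hinv : ∀ p : PairGroup G,
      (∀ t, cls p * cls t * (cls p)⁻¹ =
        cls (FreeGroup.map (letterConj (canonicalMap G p : G)) t)) →
      ∀ t, cls p⁻¹ * cls t * (cls p⁻¹)⁻¹ =
        cls (FreeGroup.map (letterConj (canonicalMap G p⁻¹ : G)) t) := by
    intro p hp t
    have := hp (FreeGroup.map (letterConj (canonicalMap G p⁻¹ : G)) t)
    rw [letterConj_mul, map_inv, Subgroup.coe_inv, mul_inv_cancel, letterConj_one] at this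
    rw [← this, map_inv, Subgroup.coe_inv, cls, cls, QuotientGroup.mk_inv]
    group
  have hs : ∀ a : G, ∀ t, cls (sqr a) * cls t * (cls (sqr a))⁻¹ =
        cls (FreeGroup.map (letterConj (canonicalMap G (sqr a) : G)) t) := by
    intro a t; rw [hsq]; exact conj_cls_sqr a t
  have hval : ∀ p q : PairGroup G, Relation p q → canonicalMap G p = canonicalMap G q := by
    intro p q h
    have := relationSubgroup_le (Subgroup.subset_normalClosure ⟨p, q, h, rfl⟩)
    rwa [pairKernel, MonoidHom.mem_ker, map_mul, map_inv, mul_inv_eq_one] at this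
  induction p using FreeGroup.induction_on with
  | C1 => intro t; rw [map_one, Subgroup.coe_one, letterConj_one]; simp
  | of l =>
    cases l with
    | square a => exact hs a
    | unoriented x y =>
      have h := Relation.r2 x (x⁻¹ * y)
      rw [mul_inv_cancel_left] at h
      intro t
      rw [hval _ _ h, cls_rel h]
      exact hmul _ _ (hs _) (hs _) t
    | oriented x y =>
      have h := Relation.r3 x y
      intro t
      rw [hval _ _ h, cls_rel h]
      exact hmul _ _ (hmul _ _ (hs _) (hs _)) (hs _) t
  | inv_of l ih => exact hinv _ ih
  | mul p q hp hq => exact hmul p q hp hq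

/-- The unoriented Schur multiplier is an abelian group. -/
instance : CommGroup (SchurMultiplier G) where
  __ := (inferInstance : Group (SchurMultiplier G))
  mul_comm := by
    intro a b
    induction a using QuotientGroup.induction_on with | H p => ?_
    induction b using QuotientGroup.induction_on with | H q => ?_
    have h := conj_cls p.1 q.1
    rw [show canonicalMap G p.1 = 1 from p.2, Subgroup.coe_one, letterConj_one,
      mul_inv_eq_iff_eq_mul] at h
    rw [← QuotientGroup.mk_mul, ← QuotientGroup.mk_mul, QuotientGroup.eq, Subgroup.mem_subgroupOf]
    rw [cls, cls, ← QuotientGroup.mk_mul, ← QuotientGroup.mk_mul, QuotientGroup.eq] at h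
    exact h

/-! ### The unoriented Bogomolov multiplier -/

variable (G) in
/-- The elements of `M(G; ℤ₂)` represented by one letter of the kernel: the classes over the
torus `⟨x, y⟩` with `[x, y] = 1`, over the Klein bottle `(x, y)` with `{x, y} = 1`, and over the
projective plane `(z)` with `z ^ 2 = 1`. -/
def surfaceClasses : Set (SchurMultiplier G) :=
  {c | ∃ k : pairKernel G, c = QuotientGroup.mk k ∧
    ((∃ x y : G, comm x y = 1 ∧ (k : PairGroup G) = ori x y) ∨
     (∃ x y : G, ucomm x y = 1 ∧ (k : PairGroup G) = uno x y) ∨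
     (∃ z : G, z ^ 2 = 1 ∧ (k : PairGroup G) = sqr z))}

variable (G) in
/-- The unoriented Bogomolov multiplier `B₀(G; ℤ₂)`: the quotient of the unoriented Schur
multiplier by the subgroup generated by the classes over the torus, the Klein bottle and the
projective plane. -/
abbrev BogomolovMultiplier : Type u := SchurMultiplier G ⧸ Subgroup.closure (surfaceClasses G)

end

end Unoriented

/-! Let `Q` be the group `(G, G)` modulo the words of the kernel whose classes come from surfaces.
The canonical map induces `boundary : Q → G`, and its kernel is `B₀(G; ℤ₂)`, so it suffices that
`boundary` is injective. In `Q`, `qsqr z = 1` for `z ^ 2 = 1`, `qori x y = 1` for commuting `x`,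
`y`, and the `qsqr x` generate.

For abelian and dihedral groups every element of `Q` is some `qsqr x`. If its boundary `x ^ 2` is
trivial, it is a projective plane class, hence `1`.

For symmetric groups `Q` is generated by lifts of 3-cycles (`qsqr_mem_triSubgroup`). These satisfy
enough relations of the alternating group: conjugation (`triLift_mul`), and `(a b c)(c b d) = (a b
d)` (`triLift_mul_triLift`), which expresses that disjoint transpositions span a torus. They give
coset decompositions along point stabilizers (`mem_triSubgroup_insert`), and an element with trivial
boundary descends through smaller point sets until it is `1`. -/

namespace Unoriented

open Equiv

/-! ### Reduction to injectivity of `boundary` -/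

section General

variable {G : Type u} [Group G]

variable (G) in
/-- The words of the kernel whose classes are generated by the surface classes. -/
def surfaceSubgroup : Subgroup (PairGroup G) :=
  ((Subgroup.closure (surfaceClasses G)).comap (QuotientGroup.mk' _)).map (pairKernel G).subtype

theorem mem_surfaceSubgroup {w : PairGroup G} : w ∈ surfaceSubgroup G ↔
    ∃ h : w ∈ pairKernel G,
      (QuotientGroup.mk ⟨w, h⟩ : SchurMultiplier G) ∈ Subgroup.closure (surfaceClasses G) := by
  constructor
  · rintro ⟨k, hk, rfl⟩
    exact ⟨k.2, hk⟩
  · rintro ⟨h, hw⟩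
    exact ⟨⟨w, h⟩, hw, rfl⟩

theorem relationSubgroup_le_surfaceSubgroup : relationSubgroup G ≤ surfaceSubgroup G := by
  intro w hw
  refine mem_surfaceSubgroup.2 ⟨relationSubgroup_le hw, ?_⟩
  rw [(QuotientGroup.eq_one_iff _).2 (Subgroup.mem_subgroupOf.2 hw)]
  exact one_mem _

theorem surfaceSubgroup_le : surfaceSubgroup G ≤ pairKernel G :=
  fun _ hw => (mem_surfaceSubgroup.1 hw).1

/-- The classes of words in the kernel are central. -/
theorem cls_commute {k : PairGroup G} (hk : k ∈ pairKernel G) (t : PairGroup G) :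
    cls k * cls t = cls t * cls k := by
  have h := conj_cls k t
  rwa [show canonicalMap G k = 1 from hk, Subgroup.coe_one, letterConj_one,
    mul_inv_eq_iff_eq_mul] at h

/-- Kernel words are central modulo the relations, so conjugation changes them only by an element of
`relationSubgroup G`. -/
instance : (surfaceSubgroup G).Normal where
  conj_mem k hk p := by
    have h : p * k * p⁻¹ * k⁻¹ ∈ relationSubgroup G := by
      rw [← QuotientGroup.eq_one_iff]
      change cls p * cls k * (cls p)⁻¹ * (cls k)⁻¹ = 1
      rw [← cls_commute (surfaceSubgroup_le hk)]
      group
    have := mul_mem (relationSubgroup_le_surfaceSubgroup h) hk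
    simpa using this

variable (G) in
/-- The quotient of the group of words by the surface classes. -/
abbrev SurfaceQuotient : Type u := PairGroup G ⧸ surfaceSubgroup G

variable (G) in
/-- The projection from the group of classes of words to its quotient by the surface classes. -/
def toQuotient : (PairGroup G ⧸ relationSubgroup G) →* SurfaceQuotient G :=
  QuotientGroup.map _ _ (MonoidHom.id _) relationSubgroup_le_surfaceSubgroup

/-- The image of `(x)` in the quotient by the surface classes. -/
def qsqr (x : G) : SurfaceQuotient G := toQuotient G (cls (sqr x))

/-- The image of `⟨x, y⟩` in the quotient by the surface classes. -/
def qori (x y : G) : SurfaceQuotient G := toQuotient G (cls (ori x y))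

theorem qsqr_one : qsqr (1 : G) = 1 := by rw [qsqr, cls_sqr_one, map_one]

theorem qsqr_inv (x : G) : qsqr x⁻¹ = (qsqr x)⁻¹ := by rw [qsqr, cls_sqr_inv, map_inv, qsqr]

theorem qsqr_zpow_mul_zpow (x : G) (i j : ℤ) :
    qsqr (x ^ i) * qsqr (x ^ j) = qsqr (x ^ (i + j)) := by
  have := congrArg (toQuotient G) (cls_rel (Relation.r1 x i j))
  rwa [cls_mul, map_mul] at this

theorem qsqr_mul_self (x : G) : qsqr x * qsqr x = qsqr (x * x) := by
  have h := qsqr_zpow_mul_zpow x 1 1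
  rwa [zpow_add, zpow_one] at h

theorem qori_eq (x y : G) : qori x y = qsqr x * qsqr (x⁻¹ * y) * (qsqr y)⁻¹ := by
  rw [qori, cls_ori, map_mul, map_mul, map_inv]; rfl

theorem qsqr_mul (x y : G) : qsqr x * qsqr y = qori x (x * y) * qsqr (x * y) := by
  rw [qori_eq, inv_mul_cancel_left, inv_mul_cancel_right]

theorem qori_swap (x y : G) : qori x y = (qori y x)⁻¹ := by
  have := congrArg (toQuotient G) (cls_ori_inv x y)
  rw [map_mul, map_one] at this
  exact eq_inv_of_mul_eq_one_left this

theorem qori_mul (x y z : G) : qori (x * y) z = qori (cj x y) (cj x z) * qori x z := by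
  rw [qori, cls_ori_mul, map_mul]; rfl

theorem qsqr_conj (x y : G) : qsqr x * qsqr y * (qsqr x)⁻¹ = qsqr (cj (x ^ 2) y) := by
  have := congrArg (toQuotient G) (cls_sqr_conj_sqr x y)
  rwa [map_mul, map_mul, map_inv] at this

theorem qsqr_eq_one {z : G} (hz : z ^ 2 = 1) : qsqr z = 1 := by
  refine (QuotientGroup.eq_one_iff (sqr z)).2 (mem_surfaceSubgroup.2 ⟨?_, ?_⟩)
  · rw [pairKernel, MonoidHom.mem_ker]
    exact Subtype.ext (by simpa [canonicalMap, letterValue] using hz)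
  · exact Subgroup.subset_closure ⟨_, rfl, Or.inr (Or.inr ⟨z, hz, rfl⟩)⟩

theorem qori_eq_one {x y : G} (h : comm x y = 1) : qori x y = 1 := by
  refine (QuotientGroup.eq_one_iff (ori x y)).2 (mem_surfaceSubgroup.2 ⟨?_, ?_⟩)
  · rw [pairKernel, MonoidHom.mem_ker]
    exact Subtype.ext (by simpa [canonicalMap, letterValue] using h)
  · exact Subgroup.subset_closure ⟨_, rfl, Or.inl ⟨x, y, h, rfl⟩⟩

variable (G) in
/-- The map to `G` induced by the canonical map. -/
def boundary : SurfaceQuotient G →* G :=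
  QuotientGroup.lift (surfaceSubgroup G) ((squareSubgroup G).subtype.comp (canonicalMap G))
    fun w hw => by
      rw [MonoidHom.mem_ker, MonoidHom.comp_apply, show canonicalMap G w = 1 from surfaceSubgroup_le hw, map_one]

theorem boundary_qsqr (x : G) : boundary G (qsqr x) = x ^ 2 := by
  change ((canonicalMap G (sqr x) : squareSubgroup G) : G) = x ^ 2
  simp [canonicalMap, letterValue]

/-- The quotient by the surface classes is generated by the images of the square elements. -/
theorem mem_of_qsqr_mem (H : Subgroup (SurfaceQuotient G)) (hH : ∀ x, qsqr x ∈ H)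
    (q : SurfaceQuotient G) : q ∈ H := by
  induction q using QuotientGroup.induction_on with | H w => ?_
  induction w using FreeGroup.induction_on with
  | C1 => exact one_mem H
  | of l =>
    cases l with
    | square z => exact hH z
    | unoriented x y =>
      change toQuotient G (cls (uno x y)) ∈ H
      rw [cls_uno, map_mul]
      exact mul_mem (hH _) (hH _)
    | oriented x y =>
      change qori x y ∈ H
      rw [qori_eq]
      exact mul_mem (mul_mem (hH _) (hH _)) (inv_mem (hH _))
  | inv_of l ih => exact inv_mem ih
  | mul p q hp hq => exact mul_mem hp hq

/-- A class of the Schur multiplier is represented by a word with trivial boundary. Injectivity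
makes that word trivial in the quotient, that is, a product of surface classes. -/
theorem closure_surfaceClasses_eq_top (h : Function.Injective (boundary G)) :
    Subgroup.closure (surfaceClasses G) = ⊤ ∧ Subsingleton (BogomolovMultiplier G) := by
  have key : Subgroup.closure (surfaceClasses G) = ⊤ := by
    refine eq_top_iff.2 fun c _ => ?_
    induction c using QuotientGroup.induction_on with | H k => ?_
    have h1 : (QuotientGroup.mk k.1 : SurfaceQuotient G) = 1 := by
      refine h ?_
      change ((canonicalMap G k.1 : squareSubgroup G) : G) = _
      rw [show canonicalMap G k.1 = 1 from k.2, map_one, Subgroup.coe_one]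
    exact (mem_surfaceSubgroup.1 ((QuotientGroup.eq_one_iff _).1 h1)).2
  exact ⟨key, by rw [BogomolovMultiplier, key]; exact QuotientGroup.subsingleton_quotient_top⟩

theorem boundary_injective_of_forall_eq_qsqr
    (h : ∀ q : SurfaceQuotient G, ∃ x, q = qsqr x) : Function.Injective (boundary G) := by
  refine (injective_iff_map_eq_one _).2 fun q hq => ?_
  obtain ⟨x, rfl⟩ := h q
  exact qsqr_eq_one (by rwa [boundary_qsqr] at hq)

end General

/-! ### Abelian and dihedral groups -/

/-- The torus classes are the only obstruction to `qsqr` being multiplicative, so its image is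
already the whole quotient. -/
theorem boundary_injective_of_comm (G : Type u) [CommGroup G] :
    Function.Injective (boundary G) := by
  have hmul (x y : G) : qsqr (x * y) = qsqr x * qsqr y := by
    rw [qsqr_mul, qori_eq_one, one_mul]
    simp [comm]
  let f : G →* SurfaceQuotient G := MonoidHom.mk' qsqr hmul
  refine boundary_injective_of_forall_eq_qsqr fun q => ?_
  obtain ⟨x, hx⟩ := mem_of_qsqr_mem f.range (fun x => ⟨x, rfl⟩) q
  exact ⟨x, hx.symm⟩

/-- Reflections are involutions and contribute nothing, and the rotations are powers of one element,
on which relation `r1` makes `qsqr` additive in the exponent. -/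
theorem boundary_injective_dihedralGroup (n : ℕ) :
    Function.Injective (boundary (DihedralGroup n)) := by
  let f : Multiplicative ℤ →* SurfaceQuotient (DihedralGroup n) :=
    MonoidHom.mk' (fun i => qsqr (DihedralGroup.r 1 ^ i.toAdd)) fun i j => by
      rw [qsqr_zpow_mul_zpow, toAdd_mul]
  refine boundary_injective_of_forall_eq_qsqr fun q => ?_
  have hf : ∀ x : DihedralGroup n, qsqr x ∈ f.range := by
    rintro (i | i)
    · obtain ⟨k, rfl⟩ := ZMod.intCast_surjective i
      refine ⟨Multiplicative.ofAdd k, ?_⟩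
      simp [f]
    · rw [qsqr_eq_one]
      · exact one_mem _
      · rw [pow_two, DihedralGroup.sr_mul_self]
  obtain ⟨i, hi⟩ := mem_of_qsqr_mem f.range hf q
  exact ⟨_, hi.symm⟩

/-! ### Symmetric groups: lifts of 3-cycles and their relations -/

section Symmetric

variable {α : Type u} [DecidableEq α]

/-- The `3`-cycle `a ↦ b ↦ c ↦ a`. -/
def tri (a b c : α) : Perm α := swap a b * swap b c

theorem cj_swap (g : Perm α) (a b : α) : cj g (swap a b) = swap (g a) (g b) := by
  rw [cj, swap_apply_apply]

theorem cj_tri (g : Perm α) (a b c : α) : cj g (tri a b c) = tri (g a) (g b) (g c) := by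
  rw [tri, cj_mul, cj_swap, cj_swap, tri]

theorem tri_inv (a b c : α) : (tri a b c)⁻¹ = tri c b a := by
  rw [tri, mul_inv_rev, swap_inv, swap_inv, swap_comm b c, swap_comm a b, tri]

theorem tri_apply_left {a b c : α} (hab : a ≠ b) (hac : a ≠ c) : tri a b c a = b := by
  rw [tri, Perm.mul_apply, swap_apply_of_ne_of_ne hab hac, swap_apply_left]

theorem tri_apply_of_ne {a b c x : α} (ha : x ≠ a) (hb : x ≠ b) (hc : x ≠ c) :
    tri a b c x = x := by
  rw [tri, Perm.mul_apply, swap_apply_of_ne_of_ne hb hc, swap_apply_of_ne_of_ne ha hb]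

/-- Conjugating the second factor past the first. -/
theorem swap_mul_swap_comm (a b c d : α) :
    swap a b * swap c d = swap (swap a b c) (swap a b d) * swap a b := by
  rw [← cj_swap, cj, inv_mul_cancel_right]

theorem tri_rotate {a b c : α} (hab : a ≠ b) (hac : a ≠ c) : tri a b c = tri b c a := by
  rw [tri, tri, swap_comm c a, swap_mul_swap_comm b c, swap_apply_right,
    swap_apply_of_ne_of_ne hab hac]

theorem tri_mul_self {a b c : α} (hab : a ≠ b) (hac : a ≠ c) (hbc : b ≠ c) :
    tri a b c * tri a b c = tri c b a := by
  nth_rewrite 2 [tri_rotate hab hac]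
  rw [tri_rotate hbc.symm hac.symm, tri, tri, tri, mul_assoc, swap_mul_self_mul, swap_comm a b,
    swap_comm c a]

/-- The lift of a `3`-cycle to the quotient by the surface classes. -/
def triLift (a b c : α) : SurfaceQuotient (Perm α) := (qsqr (tri a b c))⁻¹

theorem triLift_rotate {a b c : α} (hab : a ≠ b) (hac : a ≠ c) :
    triLift a b c = triLift b c a := by
  rw [triLift, triLift, tri_rotate hab hac]

theorem triLift_inv (a b c : α) : (triLift a b c)⁻¹ = triLift c b a := by
  rw [triLift, triLift, ← qsqr_inv, tri_inv]

theorem triLift_mul_self {a b c : α} (hab : a ≠ b) (hac : a ≠ c) (hbc : b ≠ c) :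
    triLift a b c * triLift a b c = triLift c b a := by
  rw [triLift, triLift, ← mul_inv_rev, qsqr_mul_self, tri_mul_self hab hac hbc]

theorem tri_sq_inv {a b c : α} (hab : a ≠ b) (hac : a ≠ c) (hbc : b ≠ c) :
    ((tri a b c) ^ 2)⁻¹ = tri a b c := by
  rw [pow_two, tri_mul_self hab hac hbc, tri_inv]

/-- The square of a 3-cycle is its inverse, which is why `triLift` carries an inverse. -/
theorem boundary_triLift {a b c : α} (hab : a ≠ b) (hac : a ≠ c) (hbc : b ≠ c) :
    boundary (Perm α) (triLift a b c) = tri a b c := by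
  rw [triLift, map_inv, boundary_qsqr, tri_sq_inv hab hac hbc]

/-- An element `qsqr g` acts by conjugation through `g ^ 2`, so a lift acts through the 3-cycle that
it lifts. -/
theorem triLift_mul {a b c : α} (hab : a ≠ b) (hac : a ≠ c) (hbc : b ≠ c) (x y z : α) :
    triLift a b c * triLift x y z =
      triLift (tri a b c x) (tri a b c y) (tri a b c z) * triLift a b c := by
  rw [← mul_inv_eq_iff_eq_mul]
  simp only [triLift]
  rw [← cj_tri, ← qsqr_inv (tri x y z), ← qsqr_inv (tri a b c), qsqr_conj, inv_pow,
    tri_sq_inv hab hac hbc, cj_inv, qsqr_inv]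

theorem qsqr_swap (a b : α) : qsqr (swap a b) = 1 :=
  qsqr_eq_one (by rw [pow_two, swap_mul_self])

theorem qori_swap_swap (a b c d : α) :
    qori (swap a b) (swap c d) = qsqr (swap a b * swap c d) := by
  rw [qori_eq, qsqr_swap, qsqr_swap, swap_inv, one_mul, inv_one, mul_one]

theorem qori_swap_swap_tri (a b c : α) : qori (swap a b) (swap b c) = (triLift a b c)⁻¹ := by
  rw [qori_swap_swap, triLift, inv_inv, tri]

theorem qori_swap_swap_eq_one {a b c d : α} (hac : a ≠ c) (had : a ≠ d) (hbc : b ≠ c)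
    (hbd : b ≠ d) : qori (swap a b) (swap c d) = 1 := by
  refine qori_eq_one ?_
  rw [comm, swap_mul_swap_comm a b, swap_apply_of_ne_of_ne hac.symm hbc.symm,
    swap_apply_of_ne_of_ne had.symm hbd.symm]
  simp

/-- The relation between the lifts of `3`-cycles that comes from the torus of two disjoint
transpositions. -/
theorem triLift_mul_triLift {a b c d : α} (hab : a ≠ b) (hac : a ≠ c) (had : a ≠ d) (hbc : b ≠ c)
    (hbd : b ≠ d) (hcd : c ≠ d) : triLift a b c * triLift c b d = triLift a b d := by
  -- One 3-cycle is factored as `(c d)(c a) = (c a)(a d)`, and its pairing with `(a b)` is expanded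
  -- both ways. In the first expansion the factor from the disjoint `(c d)` and `(a b)` vanishes.
  have h1 := qori_mul (swap c d) (swap c a) (swap a b)
  have h2 := qori_mul (swap c a) (swap a d) (swap a b)
  have e : swap c d * swap c a = swap c a * swap a d := by
    rw [swap_mul_swap_comm c d, swap_apply_left, swap_apply_of_ne_of_ne hac had,
      swap_mul_swap_comm c a, swap_apply_right, swap_apply_of_ne_of_ne hcd.symm had.symm,
      swap_mul_swap_comm c d, swap_apply_left, swap_apply_of_ne_of_ne hac had]
  rw [cj_swap, cj_swap, swap_apply_left, swap_apply_of_ne_of_ne hac had,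
    swap_apply_of_ne_of_ne hbc hbd,
    qori_swap_swap_eq_one hac.symm hbc.symm had.symm hbd.symm, mul_one, e, h2, cj_swap, cj_swap,
    swap_apply_right, swap_apply_of_ne_of_ne hcd.symm had.symm,
    swap_apply_of_ne_of_ne hbc hab.symm, swap_comm c d, qori_swap_swap_tri d,
    qori_swap_swap_tri c, qori_swap_swap_tri d, ← mul_inv_rev, inv_inj] at h1
  rwa [triLift_rotate hcd.symm hbd.symm, triLift_rotate hac.symm hbc.symm,
    triLift_rotate had.symm hbd.symm] at h1

/-! ### Coset induction over the set of points -/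

/-- The subgroup generated by the lifts of the `3`-cycles on a set of points. -/
def triSubgroup (A : Set α) : Subgroup (SurfaceQuotient (Perm α)) :=
  Subgroup.closure {q | ∃ a ∈ A, ∃ b ∈ A, ∃ c ∈ A, a ≠ b ∧ a ≠ c ∧ b ≠ c ∧ q = triLift a b c}

theorem triLift_mem {A : Set α} {a b c : α} (ha : a ∈ A) (hb : b ∈ A) (hc : c ∈ A) (hab : a ≠ b)
    (hac : a ≠ c) (hbc : b ≠ c) : triLift a b c ∈ triSubgroup A :=
  Subgroup.subset_closure ⟨a, ha, b, hb, c, hc, hab, hac, hbc, rfl⟩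

/-- Induction by left multiplication with lifts of `3`-cycles. -/
theorem triSubgroup_induction {A : Set α} {p : SurfaceQuotient (Perm α) → Prop} (one : p 1)
    (mul : ∀ a ∈ A, ∀ b ∈ A, ∀ c ∈ A, a ≠ b → a ≠ c → b ≠ c → ∀ q, p q → p (triLift a b c * q))
    {q : SurfaceQuotient (Perm α)} (hq : q ∈ triSubgroup A) : p q := by
  refine Subgroup.closure_induction_left (p := fun q _ => p q) one ?_ ?_ hq
  · rintro _ ⟨a, ha, b, hb, c, hc, hab, hac, hbc, rfl⟩ q _ h
    exact mul a ha b hb c hc hab hac hbc q h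
  · rintro _ ⟨a, ha, b, hb, c, hc, hab, hac, hbc, rfl⟩ q _ h
    rw [triLift_inv]
    exact mul c hc b hb a ha hbc.symm hac.symm hab.symm q h

theorem tri_apply_mem {A : Set α} {a b c x : α} (ha : a ∈ A) (hb : b ∈ A) (hc : c ∈ A)
    (hx : x ∈ A) : tri a b c x ∈ A := by
  simp only [tri, Perm.mul_apply, swap_apply_def]
  split_ifs <;> assumption

theorem boundary_apply_of_notMem {A : Set α} {p : α} (hp : p ∉ A)
    {q : SurfaceQuotient (Perm α)} (hq : q ∈ triSubgroup A) : boundary (Perm α) q p = p := by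
  refine triSubgroup_induction (p := fun q => boundary (Perm α) q p = p) (by simp) ?_ hq
  intro a ha b hb c hc hab hac hbc q h
  rw [map_mul, Perm.mul_apply, h, boundary_triLift hab hac hbc]
  exact tri_apply_of_ne (by rintro rfl; exact hp ha) (by rintro rfl; exact hp hb)
    (by rintro rfl; exact hp hc)

/-- The coset of `triSubgroup A` of the elements that move `p` to `a` does not depend on the
third point of the `3`-cycle. -/
theorem triLift_change {A : Set α} {p a b b' : α} (hp : p ∉ A) (ha : a ∈ A) (hb : b ∈ A)
    (hb' : b' ∈ A) (hab : a ≠ b) (hab' : a ≠ b') :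
    ∃ h ∈ triSubgroup A, triLift p a b = triLift p a b' * h := by
  have ne : ∀ x ∈ A, p ≠ x := by rintro x hx rfl; exact hp hx
  rcases eq_or_ne b b' with rfl | hbb
  · exact ⟨1, one_mem _, (mul_one _).symm⟩
  -- The witness is read off from `(b' a p)(p a b) = (b' a b)`, where `(b' a p)` inverts `(p a b')`.
  · refine ⟨triLift b' a b, triLift_mem hb' ha hb hab'.symm hbb.symm hab, ?_⟩
    rw [← inv_mul_eq_iff_eq_mul, triLift_inv]
    exact triLift_mul_triLift hab'.symm (ne _ hb').symm hbb.symm (ne _ ha).symm hab (ne _ hb)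

/-- The coset decomposition of the group of the set `insert p A` by the stabilizer of `p`. -/
theorem mem_triSubgroup_insert {A : Set α} {p : α} (hp : p ∉ A) {q : SurfaceQuotient (Perm α)}
    (hq : q ∈ triSubgroup (insert p A)) : q ∈ triSubgroup A ∨
      ∃ a ∈ A, ∃ b ∈ A, a ≠ b ∧ ∃ h ∈ triSubgroup A, q = triLift p a b * h := by
  have ne : ∀ x ∈ A, p ≠ x := by rintro x hx rfl; exact hp hx
  let U (q : SurfaceQuotient (Perm α)) : Prop := q ∈ triSubgroup A ∨
      ∃ a ∈ A, ∃ b ∈ A, a ≠ b ∧ ∃ h ∈ triSubgroup A, q = triLift p a b * h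
  have hfix : ∀ a ∈ A, ∀ b ∈ A, ∀ c ∈ A, a ≠ b → a ≠ c → b ≠ c → ∀ q, U q →
      U (triLift a b c * q) := by
    rintro a ha b hb c hc hab hac hbc q (hq | ⟨x, hx, y, hy, hxy, h, hh, rfl⟩)
    · exact Or.inl (mul_mem (triLift_mem ha hb hc hab hac hbc) hq)
    · refine Or.inr ⟨_, tri_apply_mem ha hb hc hx, _, tri_apply_mem ha hb hc hy,
        (tri a b c).injective.ne hxy, _, mul_mem (triLift_mem ha hb hc hab hac hbc) hh, ?_⟩
      rw [← mul_assoc, triLift_mul hab hac hbc, tri_apply_of_ne (ne a ha) (ne b hb) (ne c hc),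
        mul_assoc]
  have hmove : ∀ x ∈ A, ∀ y ∈ A, x ≠ y → ∀ q, U q → U (triLift p x y * q) := by
    rintro x hx y hy hxy q (hq | ⟨a, ha, b, hb, hab, h, hh, rfl⟩)
    · exact Or.inr ⟨x, hx, y, hy, hxy, q, hq, rfl⟩
    -- The new coset is determined by the image of `a` under `(p x y)`: it is `y` if `a = x`, `p` if
    -- `a = y`, and `a` otherwise. In each case `triLift_change` first replaces `b` by a point for
    -- which the product of the two lifts is known.
    · rcases eq_or_ne a x with rfl | hax
      · obtain ⟨k, hk, e⟩ := triLift_change hp ha hb hy hab hxy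
        refine Or.inr ⟨y, hy, a, ha, hxy.symm, k * h, mul_mem hk hh, ?_⟩
        rw [e, ← mul_assoc, ← mul_assoc, triLift_mul_self (ne a ha) (ne y hy) hxy,
          triLift_rotate hxy.symm (ne y hy).symm, triLift_rotate (ne a ha).symm hxy, mul_assoc]
      · obtain ⟨k, hk, e⟩ := triLift_change hp ha hb hx hab hax
        rcases eq_or_ne a y with rfl | hay
        · left
          rw [e, ← mul_assoc, ← mul_assoc]
          have : triLift p x a * triLift p a x = 1 := by
            rw [triLift_rotate (ne x hx) (ne a ha), ← triLift_inv x a p, mul_inv_cancel]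
          rw [this, one_mul]
          exact mul_mem hk hh
        · refine Or.inr ⟨a, ha, y, hy, hay, k * h, mul_mem hk hh, ?_⟩
          rw [e, ← mul_assoc, ← mul_assoc, mul_assoc]
          congr 1
          rw [← triLift_rotate (ne y hy).symm hxy.symm, ← triLift_rotate (ne x hx).symm hax.symm,
            triLift_mul_triLift (ne y hy).symm hxy.symm hay.symm (ne x hx) (ne a ha) hax.symm,
            triLift_rotate (ne y hy).symm hay.symm]
  refine triSubgroup_induction (p := U) (Or.inl (one_mem _)) ?_ hq
  intro a ha b hb c hc hab hac hbc q hU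
  rcases ha with rfl | ha
  · exact hmove b (hb.resolve_left hab.symm) c (hc.resolve_left hac.symm) hbc q hU
  · rcases hb with rfl | hb
    · rw [triLift_rotate hab hac]
      exact hmove c (hc.resolve_left hbc.symm) a ha hac.symm q hU
    · rcases hc with rfl | hc
      · rw [triLift_rotate hab hac, triLift_rotate hbc hab.symm]
        exact hmove a ha b hb hab q hU
      · exact hfix a ha b hb c hc hab hac hbc q hU

/-- The nontrivial cosets move `p` to a point `a ≠ p`, so trivial boundary forces the element into
the subgroup for the smaller set. -/
theorem eq_one_of_mem_triSubgroup (A : Finset α) : ∀ q ∈ triSubgroup (A : Set α),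
    boundary (Perm α) q = 1 → q = 1 := by
  induction A using Finset.induction_on with
  | empty =>
    intro q hq _
    exact triSubgroup_induction (p := fun q => q = 1) rfl (fun a ha => by simp at ha) hq
  | insert p A hp ih =>
    intro q hq h1
    have hp' : p ∉ (A : Set α) := by simpa using hp
    rw [Finset.coe_insert] at hq
    rcases mem_triSubgroup_insert hp' hq with hq | ⟨a, ha, b, hb, hab, h, hh, rfl⟩
    · exact ih q hq h1
    · have hpa : p ≠ a := by rintro rfl; exact hp' ha
      have hpb : p ≠ b := by rintro rfl; exact hp' hb
      have := DFunLike.congr_fun h1 p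
      rw [map_mul, Perm.mul_apply, boundary_apply_of_notMem hp' hh, boundary_triLift hpa hpb hab,
        tri_apply_left hpa hpb, Perm.one_apply] at this
      exact absurd this.symm hpa

/-! ### Generation by lifts of 3-cycles -/

theorem qori_swap_swap_mem (a b c d : α) :
    qori (swap a b) (swap c d) ∈ triSubgroup (Set.univ : Set α) := by
  have h3 : ∀ a b c : α, qori (swap a b) (swap b c) ∈ triSubgroup (Set.univ : Set α) := by
    intro a b c
    -- In the degenerate cases the two transpositions commute, and the pair is a torus class.
    by_cases h : a = b ∨ a = c ∨ b = c
    · rw [qori_eq_one]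
      · exact one_mem _
      · rcases h with rfl | rfl | rfl
        · simp [comm, ← Perm.one_def]
        · simp [comm, swap_comm]
        · simp [comm, ← Perm.one_def]
    · push Not at h
      rw [qori_swap_swap_tri]
      exact inv_mem (triLift_mem trivial trivial trivial h.1 h.2.1 h.2.2)
  rcases eq_or_ne b c with rfl | hbc
  · exact h3 a b d
  rcases eq_or_ne b d with rfl | hbd
  · rw [swap_comm c b]; exact h3 a b c
  rcases eq_or_ne a c with rfl | hac
  · rw [swap_comm a b]; exact h3 b a d
  rcases eq_or_ne a d with rfl | had
  · rw [swap_comm a b, swap_comm c a]; exact h3 b a c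
  rw [qori_swap_swap_eq_one hac had hbc hbd]
  exact one_mem _

/-- Since `qsqr` kills transpositions, multiplying `g` by a transposition `s` on the left changes
`qsqr g` only by the factor `qori (s * g) s`. By `qori_mul` this factor is a product of pairings of
two transpositions. -/
theorem qsqr_mem_triSubgroup [Finite α] (g : Perm α) :
    qsqr g ∈ triSubgroup (Set.univ : Set α) := by
  have hori : ∀ (g : Perm α) (a b : α), qori g (swap a b) ∈ triSubgroup (Set.univ : Set α) := by
    intro g a b
    induction g using Perm.swap_induction_on' with
    | one =>
      rw [qori_eq, qsqr_one]
      simp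
    | mul_swap g x y hxy ih =>
      rw [qori_mul, cj_swap, cj_swap]
      exact mul_mem (qori_swap_swap_mem _ _ _ _) ih
  induction g using Perm.swap_induction_on with
  | one => rw [qsqr_one]; exact one_mem _
  | swap_mul g x y hxy ih =>
    have h := qsqr_mul (swap x y) g
    rw [qsqr_swap, one_mul, qori_swap, eq_inv_mul_iff_mul_eq] at h
    rw [← h]
    exact mul_mem (hori _ _ _) ih

theorem boundary_injective_perm (α : Type u) [DecidableEq α] [Finite α] :
    Function.Injective (boundary (Perm α)) := by
  have := Fintype.ofFinite α
  refine (injective_iff_map_eq_one _).2 fun q hq => ?_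
  refine eq_one_of_mem_triSubgroup Finset.univ q ?_ hq
  rw [Finset.coe_univ]
  exact mem_of_qsqr_mem _ qsqr_mem_triSubgroup q

end Symmetric

end Unoriented

theorem mainTheorem4 :
    (∀ (G : Type u) [CommGroup G] [Finite G],
      Subgroup.closure (Unoriented.surfaceClasses G) = ⊤ ∧
        Subsingleton (Unoriented.BogomolovMultiplier G)) ∧
    (∀ n : ℕ, 1 ≤ n →
      Subgroup.closure (Unoriented.surfaceClasses (DihedralGroup n)) = ⊤ ∧
        Subsingleton (Unoriented.BogomolovMultiplier (DihedralGroup n))) ∧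
    (∀ n : ℕ,
      Subgroup.closure (Unoriented.surfaceClasses (Equiv.Perm (Fin n))) = ⊤ ∧
        Subsingleton (Unoriented.BogomolovMultiplier (Equiv.Perm (Fin n)))) := by
  exact ⟨fun G _ _ => Unoriented.closure_surfaceClasses_eq_top
      (Unoriented.boundary_injective_of_comm G),
    fun n _ => Unoriented.closure_surfaceClasses_eq_top
      (Unoriented.boundary_injective_dihedralGroup n),
    fun n => Unoriented.closure_surfaceClasses_eq_top
      (Unoriented.boundary_injective_perm (Fin n))⟩
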